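/- Let $\mathbb{F}_q$ be a finite field with $q$ elements, let $n\ge 3$ be an integer, and let $C\subset\mathbb{P}^n$ be an absolutely irreducible projective algebraic curve of degree $d$ defined over $\mathbb{F}_q$ that is non-degenerate, i.e. not contained in any hyperplane of $\mathbb{P}^n$. Write $C(\mathbb{F}_q)$ for the set of $\mathbb{F}_q$-rational points of $C$. If $d\ge (n-1)q+1$, then $|C(\mathbb{F}_q)|\le q(d-n+1)$. If $d=(n-1)q$, then $|C(\mathbb{F}_q)|\le q(d-n+1)+1$. -/

import Mathlib

/-- `ℙⁿ(K)`: the lines through the origin in `K ^ (n + 1)`. -/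
abbrev ProjSpace (K : Type*) [Field K] (n : ℕ) : Type _ :=
  Projectivization K (Fin (n + 1) → K)

/-- A polynomial `f` over `F` vanishes at `P ∈ ℙⁿ(K)`. The notion is only used for homogeneous
`f`, for which it does not depend on the chosen representative of `P`
(see `vanishesAt_mk_iff`). -/
def VanishesAt {F K : Type*} [Field F] [Field K] [Algebra F K] {n : ℕ}
    (f : MvPolynomial (Fin (n + 1)) F) (P : ProjSpace K n) : Prop :=
  MvPolynomial.aeval P.rep f = 0

theorem vanishesAt_mk_iff {F K : Type*} [Field F] [Field K] [Algebra F K] {n m : ℕ}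
    {f : MvPolynomial (Fin (n + 1)) F} (hf : f.IsHomogeneous m)
    (v : Fin (n + 1) → K) (hv : v ≠ 0) :
    VanishesAt f (Projectivization.mk K v hv) ↔ MvPolynomial.aeval v f = 0 := by
  obtain ⟨a, ha⟩ := Projectivization.exists_smul_eq_mk_rep K v hv
  have h : MvPolynomial.aeval (Projectivization.mk K v hv).rep f
      = (a : K) ^ m * MvPolynomial.aeval v f := by
    rw [← ha]
    rw [show a • v = fun i => (a : K) * v i from rfl, MvPolynomial.aeval_def,
      MvPolynomial.aeval_def, MvPolynomial.eval₂_eq', MvPolynomial.eval₂_eq', Finset.mul_sum]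
    refine Finset.sum_congr rfl fun e he => ?_
    have hdeg : ∑ i, e i = m := by
      simpa [Finsupp.weight_apply, Finsupp.sum_fintype] using
        hf (MvPolynomial.mem_support_iff.mp he)
    simp only [mul_pow, Finset.prod_mul_distrib, Finset.prod_pow_eq_pow_sum, hdeg]
    ring
  unfold VanishesAt
  rw [h]
  simp

/-- The Zariski topology on `ℙⁿ(K)`: it is generated by the complements of the hypersurfaces
`f = 0`, where `f` is a homogeneous polynomial over `K` (these are closed under finite
intersections). -/
@[reducible]
def zariskiTopology (K : Type*) [Field K] (n : ℕ) : TopologicalSpace (ProjSpace K n) :=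
  TopologicalSpace.generateFrom
    {U | ∃ (m : ℕ) (f : MvPolynomial (Fin (n + 1)) K),
      f.IsHomogeneous m ∧ U = {P | ¬ VanishesAt f P}}

/-- `C ⊆ ℙⁿ(K)` is a projective algebraic set defined over the subfield `F`: the set of common
zeros of some homogeneous polynomials with coefficients in `F`. -/
def IsAlgebraicSetOver (F : Type*) {K : Type*} [Field F] [Field K] [Algebra F K] {n : ℕ}
    (C : Set (ProjSpace K n)) : Prop :=
  ∃ T : Set (MvPolynomial (Fin (n + 1)) F),
    (∀ f ∈ T, ∃ m, f.IsHomogeneous m) ∧ C = {P | ∀ f ∈ T, VanishesAt f P}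

/-- For `K` an algebraic closure of `F`: `C ⊆ ℙⁿ(K)` is an absolutely irreducible projective
algebraic curve defined over `F`. -/
structure IsAbsolutelyIrreducibleCurve (F : Type*) {K : Type*} [Field F] [Field K] [Algebra F K]
    {n : ℕ} (C : Set (ProjSpace K n)) : Prop where
  definedOver : IsAlgebraicSetOver F C
  irreducible : @IsIrreducible _ (zariskiTopology K n) C
  dim_eq_one : @topologicalKrullDim C (@instTopologicalSpaceSubtype _ _ (zariskiTopology K n)) = 1

/-- `C` is contained in no hyperplane of `ℙⁿ(K)`. -/
def IsNondegenerate {K : Type*} [Field K] {n : ℕ} (C : Set (ProjSpace K n)) : Prop :=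
  ∀ a : Fin (n + 1) → K, a ≠ 0 → ¬ C ⊆ {P | ∑ i, a i * P.rep i = 0}

/-- The forms of degree `m` over `F` that vanish on `C`, that is, the degree `m` part of the
homogeneous ideal of `C`. -/
def vanishingForms (F : Type*) {K : Type*} [Field F] [Field K] [Algebra F K] {n : ℕ}
    (C : Set (ProjSpace K n)) (m : ℕ) :
    Submodule F (MvPolynomial.homogeneousSubmodule (Fin (n + 1)) F m) where
  carrier := {f | ∀ P ∈ C, VanishesAt (f : MvPolynomial (Fin (n + 1)) F) P}
  zero_mem' := by intro P _; simp [VanishesAt]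
  add_mem' := by
    intro f g hf hg P hP
    have h1 := hf P hP
    have h2 := hg P hP
    simp only [VanishesAt] at h1 h2 ⊢
    simp [h1, h2]
  smul_mem' := by
    intro c f hf P hP
    have h1 := hf P hP
    simp only [VanishesAt] at h1 ⊢
    simp [h1]

/-- The Hilbert function of `C`: the dimension over `F` of the degree `m` part of the homogeneous
coordinate ring of `C` over `F`. (When `F` is perfect, `K` is an algebraic closure of `F` and `C`
is defined over `F`, extending scalars from `F` to `K` does not change this dimension.) -/
noncomputable def hilbertFunction (F : Type*) {K : Type*} [Field F] [Field K] [Algebra F K]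
    {n : ℕ} (C : Set (ProjSpace K n)) (m : ℕ) : ℕ :=
  Module.finrank F
    (MvPolynomial.homogeneousSubmodule (Fin (n + 1)) F m ⧸ vanishingForms F C m)

/-- The curve `C` has degree `d`: its Hilbert polynomial is `d * m + c` for some `c`. -/
def HasCurveDegree (F : Type*) {K : Type*} [Field F] [Field K] [Algebra F K] {n : ℕ}
    (C : Set (ProjSpace K n)) (d : ℕ) : Prop :=
  ∃ c : ℤ, ∀ᶠ m : ℕ in Filter.atTop, (hilbertFunction F C m : ℤ) = d * m + c

/-- `C(F)`: the points of `C` that have homogeneous coordinates in `F`. -/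
def rationalPoints (F : Type*) {K : Type*} [Field F] [Field K] [Algebra F K] {n : ℕ}
    (C : Set (ProjSpace K n)) : Set (ProjSpace K n) :=
  {P | P ∈ C ∧ ∃ (v : Fin (n + 1) → F) (hv : (fun i => algebraMap F K (v i)) ≠ 0),
    P = Projectivization.mk K (fun i => algebraMap F K (v i)) hv}

/-! Count the zeros on `C` of the product `Q` of all `Z = q ^ (n + 1) - 1` nonzero linear forms over
`F`. None of these forms vanishes identically on `C`, so by a Bézout inequality `Q` has at most `d *
Z` zeros counted with multiplicity.

At a rational point, the linear forms that vanish there make up a space of dimension `n`. Those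
among them of multiplicity at least `i` contain a subspace of codimension at most `i - 1`. Summing
over `i`, `Q` has multiplicity at least `S = ∑ (q ^ i - 1)`, `1 ≤ i ≤ n`, at the point
(`sum_le_sum_colength`). Hence `N * S ≤ d * Z` for the number `N` of rational points
(`card_mul_sum_le`), and since `(q - 1) * S = Z - (n + 1) * (q - 1)`, elementary estimates give both
bounds (`le_of_mul_sum_le`).

No normalization or intersection theory is needed. Each rational point is replaced by one valuation
ring of the function field dominating its local ring (`exists_valuationRing_dominating`), and
multiplicity is the dimension over `F` of `O / aO`. The Bézout inequality (`sum_colength_le`)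
follows from the linear growth of the Hilbert function: too many elements independent modulo `a`,
multiplied by powers of `a`, would overfill the spaces of forms of large degree (`card_le`). -/

/-! ### Colength as a valuation on rings with total divisibility -/

section Colength

variable (F : Type*) {O : Type*} [Field F] [CommRing O] [Algebra F O]

/-- The dimension over `F` of `O / xO`. -/
noncomputable def colength (x : O) : ℕ :=
  Module.finrank F (O ⧸ Ideal.span {x})

/-- All proper quotients of `O` by principal ideals are finite dimensional over `F`. -/
def FiniteColength (O : Type*) [CommRing O] [Algebra F O] : Prop :=
  ∀ x : O, x ≠ 0 → Module.Finite F (O ⧸ Ideal.span {x})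

variable {F}

/-- Multiplication by `x` gives the exact sequence `0 → O/(y) → O/(xy) → O/(x) → 0`. -/
theorem colength_mul [IsDomain O] (h : FiniteColength F O) {x y : O} (hx : x ≠ 0) (hy : y ≠ 0) :
    colength F (x * y) = colength F x + colength F y := by
  have hxy := h _ (mul_ne_zero hx hy)
  let M : O →ₗ[O] O := LinearMap.mulLeft O x
  have hM : Ideal.span {y} ≤ Submodule.comap M (Ideal.span {x * y}) := by
    rw [Ideal.span_singleton_le_iff_mem]
    exact Ideal.mem_span_singleton_self (x * y)
  let f : (O ⧸ Ideal.span {y}) →ₗ[F] (O ⧸ Ideal.span {x * y}) :=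
    (Submodule.mapQ (Ideal.span {y}) (Ideal.span {x * y}) M hM).restrictScalars F
  have hle : Ideal.span {x * y} ≤ Ideal.span {x} := by
    rw [Ideal.span_singleton_le_span_singleton]
    exact dvd_mul_right x y
  let g : (O ⧸ Ideal.span {x * y}) →ₗ[F] (O ⧸ Ideal.span {x}) :=
    (Submodule.factor hle).restrictScalars F
  have hg : Function.Surjective g := Submodule.factor_surjective hle
  have hf : Function.Injective f := by
    rw [injective_iff_map_eq_zero]
    intro z hz
    obtain ⟨z, rfl⟩ := Submodule.Quotient.mk_surjective _ z
    have hz' : x * z ∈ Ideal.span {x * y} := (Submodule.Quotient.mk_eq_zero _).1 hz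
    rw [Ideal.mem_span_singleton] at hz'
    rw [Submodule.Quotient.mk_eq_zero, Ideal.mem_span_singleton]
    exact (mul_dvd_mul_iff_left hx).1 hz'
  have hfg : LinearMap.range f = LinearMap.ker g := by
    ext z
    obtain ⟨z, rfl⟩ := Submodule.Quotient.mk_surjective _ z
    constructor
    · rintro ⟨w, hw⟩
      obtain ⟨w, rfl⟩ := Submodule.Quotient.mk_surjective _ w
      rw [← hw]
      exact (Submodule.Quotient.mk_eq_zero _).2
        (Ideal.mem_span_singleton.2 (dvd_mul_right x w))
    · intro hz
      have hz' : z ∈ Ideal.span {x} := (Submodule.Quotient.mk_eq_zero _).1 hz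
      obtain ⟨w, rfl⟩ := Ideal.mem_span_singleton.1 hz'
      exact ⟨Submodule.Quotient.mk w, rfl⟩
  have key := LinearMap.finrank_range_add_finrank_ker g
  rw [← hfg, LinearMap.finrank_range_of_inj hf, LinearMap.range_eq_top.2 hg, finrank_top] at key
  exact key.symm

theorem colength_eq_zero_iff (h : FiniteColength F O) {x : O} (hx : x ≠ 0) :
    colength F x = 0 ↔ IsUnit x := by
  have := h x hx
  rw [colength, Module.finrank_zero_iff, Ideal.Quotient.subsingleton_iff,
    Ideal.span_singleton_eq_top]

theorem colength_pow [IsDomain O] (h : FiniteColength F O) {x : O} (hx : x ≠ 0) (k : ℕ) :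
    colength F (x ^ k) = k * colength F x := by
  induction k with
  | zero => simpa using (colength_eq_zero_iff (F := F) h one_ne_zero).2 isUnit_one
  | succ k ih => rw [pow_succ, colength_mul h (pow_ne_zero k hx) hx, ih]; ring

theorem colength_prod [IsDomain O] (h : FiniteColength F O) {ι : Type*} (s : Finset ι) (f : ι → O)
    (hf : ∀ i ∈ s, f i ≠ 0) : colength F (∏ i ∈ s, f i) = ∑ i ∈ s, colength F (f i) := by
  classical
  induction s using Finset.induction_on with
  | empty => simpa using (colength_eq_zero_iff (F := F) h one_ne_zero).2 isUnit_one
  | insert i s hi ih =>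
    rw [Finset.prod_insert hi, Finset.sum_insert hi,
      colength_mul h (hf i (by simp)) (Finset.prod_ne_zero_iff.2 fun j hj => hf j (by simp [hj])),
      ih fun j hj => hf j (by simp [hj])]

theorem colength_le_of_dvd [IsDomain O] (h : FiniteColength F O) {x y : O} (hy : y ≠ 0)
    (hxy : x ∣ y) : colength F x ≤ colength F y := by
  obtain ⟨z, rfl⟩ := hxy
  rw [colength_mul h (left_ne_zero_of_mul hy) (right_ne_zero_of_mul hy)]
  omega

/-- In a ring where divisibility is total, high powers of a nonunit are divisible by any nonzero
element. -/
theorem dvd_pow_of_colength_lt [IsDomain O] (h : FiniteColength F O)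
    (htot : ∀ x y : O, x ∣ y ∨ y ∣ x) {g b : O} (hb : b ≠ 0) (hg : ¬ IsUnit g) {s : ℕ}
    (hs : colength F b < s) : b ∣ g ^ s := by
  by_cases hg0 : g = 0
  · rw [hg0, zero_pow (by omega)]
    exact dvd_zero b
  refine (htot b (g ^ s)).resolve_right fun hdvd => ?_
  have h1 := colength_le_of_dvd h hb hdvd
  rw [colength_pow h hg0] at h1
  have h2 : colength F g ≠ 0 := fun h0 => hg ((colength_eq_zero_iff h hg0).1 h0)
  nlinarith [Nat.pos_of_ne_zero h2]

/-- A generator of the ideal of nonunits. -/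
theorem exists_nonunit_dvd_nonunits [IsDomain O] (h : FiniteColength F O)
    (htot : ∀ x y : O, x ∣ y ∨ y ∣ x) {u : O} (hu : ¬ IsUnit u) (hu0 : u ≠ 0) :
    ∃ p : O, p ≠ 0 ∧ ¬ IsUnit p ∧ ∀ x : O, ¬ IsUnit x → p ∣ x := by
  classical
  have hex : ∃ k : ℕ, ∃ x : O, x ≠ 0 ∧ ¬ IsUnit x ∧ colength F x = k := ⟨_, u, hu0, hu, rfl⟩
  obtain ⟨p, hp0, hp, hpk⟩ := Nat.find_spec hex
  refine ⟨p, hp0, hp, fun x hx => ?_⟩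
  by_cases hx0 : x = 0
  · exact hx0 ▸ dvd_zero p
  refine (htot p x).elim id ?_
  rintro ⟨w, rfl⟩
  -- In the remaining case `p = x * w`, minimality of the colength of `p` leaves colength zero for
  -- `w`, so `x` and `p` are associates.
  have h1 := Nat.find_min' hex ⟨x, hx0, hx, rfl⟩
  have hw0 := right_ne_zero_of_mul hp0
  rw [colength_mul h hx0 hw0] at hpk
  have hw : IsUnit w := (colength_eq_zero_iff h hw0).1 (by omega)
  exact (hw.mul_right_dvd).2 dvd_rfl

/-- A lower bound for the number of elements of a subspace of the maximal ideal that have large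
colength. -/
theorem exists_submodule_le_colength [IsDomain O] (h : FiniteColength F O)
    (htot : ∀ x y : O, x ∣ y ∨ y ∣ x) (U : Submodule F O) [Module.Finite F U]
    (hU : ∀ u ∈ U, ¬ IsUnit u) (i : ℕ) (hi : 1 ≤ i) :
    ∃ V : Submodule F U, Module.finrank F U ≤ Module.finrank F V + (i - 1) ∧
      ∀ v ∈ V, (v : O) ≠ 0 → i ≤ colength F (v : O) := by
  classical
  by_cases hbot : ∀ u ∈ U, u = 0
  · exact ⟨⊤, by simp, fun v _ hv => absurd (hbot v v.2) hv⟩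
  push Not at hbot
  obtain ⟨u₀, hu₀, hu₀0⟩ := hbot
  obtain ⟨p, hp0, hp, hpdvd⟩ := exists_nonunit_dvd_nonunits h htot (hU u₀ hu₀) hu₀0
  have hex : ∃ k : ℕ, k ≤ i - 1 ∧ ∃ x : O, x ≠ 0 ∧ colength F x = k :=
    ⟨0, by omega, 1, one_ne_zero, (colength_eq_zero_iff h one_ne_zero).2 isUnit_one⟩
  -- The residue field may be larger than `F`, so the value `i - 1` need not be attained; `x` has
  -- the largest attained colength below `i`.
  have hmax : ∃ x : O, x ≠ 0 ∧ colength F x ≤ i - 1 ∧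
      ∀ y : O, y ≠ 0 → colength F y ≤ i - 1 → colength F y ≤ colength F x := by
    have hspec := Nat.findGreatest_spec (P := fun k => ∃ x : O, x ≠ 0 ∧ colength F x = k)
      (Nat.zero_le (i - 1)) ⟨1, one_ne_zero, (colength_eq_zero_iff h one_ne_zero).2 isUnit_one⟩
    obtain ⟨x, hx0, hx⟩ := hspec
    exact ⟨x, hx0, hx ▸ Nat.findGreatest_le _,
      fun y hy0 hy => hx ▸ Nat.le_findGreatest hy ⟨y, hy0, rfl⟩⟩
  obtain ⟨x, hx0, hxi, hxmax⟩ := hmax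
  have hxfin := h x hx0
  -- division by the generator `p`, followed by reduction modulo `x`
  let e : O →ₗ[F] O := LinearMap.mulLeft F p
  have he : Function.Injective e := fun a b hab => mul_left_cancel₀ hp0 hab
  have hUe : ∀ u : U, (u : O) ∈ LinearMap.range e := fun u => by
    obtain ⟨w, hw⟩ := hpdvd u (hU u u.2)
    exact ⟨w, hw.symm⟩
  let D : U →ₗ[F] O := (LinearEquiv.ofInjective e he).symm.toLinearMap ∘ₗ
    (U.subtype.codRestrict (LinearMap.range e) hUe)
  have hD : ∀ u : U, p * D u = u := fun u => by
    have := congrArg Subtype.val ((LinearEquiv.ofInjective e he).apply_symm_apply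
      (U.subtype.codRestrict (LinearMap.range e) hUe u))
    exact this
  let q : O →ₗ[F] (O ⧸ Ideal.span {x}) := (Submodule.mkQ (Ideal.span {x})).restrictScalars F
  refine ⟨LinearMap.ker (q ∘ₗ D), ?_, fun v hv hv0 => ?_⟩
  · have h1 := LinearMap.finrank_range_add_finrank_ker (q ∘ₗ D)
    have h2 := Submodule.finrank_le (LinearMap.range (q ∘ₗ D))
    have h3 : Module.finrank F (O ⧸ Ideal.span {x}) = colength F x := rfl
    omega
  -- An element of the kernel is a multiple of `p * x`, whose colength exceeds that of `x` and is
  -- therefore at least `i` by maximality.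
  · have hv' : D v ∈ Ideal.span {x} := (Submodule.Quotient.mk_eq_zero _).1 hv
    obtain ⟨w, hw⟩ := Ideal.mem_span_singleton.1 hv'
    have hvw : (v : O) = p * x * w := by rw [← hD v, hw]; ring
    by_contra hlt
    have hpx0 := mul_ne_zero hp0 hx0
    have h1 : colength F (p * x) ≤ colength F (v : O) :=
      colength_le_of_dvd h hv0 ⟨w, hvw⟩
    have h2 := hxmax (p * x) hpx0 (by omega)
    rw [colength_mul h hp0 hx0] at h2
    exact hp ((colength_eq_zero_iff h hp0).1 (by omega))

open Classical in
/-- The total colength of the nonzero elements of a subspace of the maximal ideal. -/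
theorem sum_le_sum_colength [IsDomain O] [Finite F] (h : FiniteColength F O)
    (htot : ∀ x y : O, x ∣ y ∨ y ∣ x) (U : Submodule F O) [Fintype U]
    (hU : ∀ u ∈ U, ¬ IsUnit u) :
    ∑ i ∈ Finset.Icc 1 (Module.finrank F U), (Nat.card F ^ i - 1) ≤
      ∑ u : U, if u = 0 then 0 else colength F (u : O) := by
  classical
  set n := Module.finrank F U with hn
  -- Layer-cake count: a colength is at least the number of `i ≤ n` that it reaches, and layer `i`
  -- contains the nonzero vectors of a subspace of dimension at least `n + 1 - i`.
  have hcount : ∀ i ∈ Finset.Icc 1 n, Nat.card F ^ (n + 1 - i) - 1 ≤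
      ∑ u : U, if u ≠ 0 ∧ i ≤ colength F (u : O) then 1 else 0 := by
    intro i hi
    rw [Finset.mem_Icc] at hi
    obtain ⟨V, hV, hVi⟩ := exists_submodule_le_colength h htot U hU i hi.1
    rw [Finset.sum_boole, Nat.cast_id]
    have hsub : (Finset.univ.filter (fun u : U => u ∈ V)).erase 0 ⊆
        Finset.univ.filter (fun u : U => u ≠ 0 ∧ i ≤ colength F (u : O)) := by
      intro u hu
      simp only [Finset.mem_erase, Finset.mem_filter, Finset.mem_univ, true_and] at hu ⊢
      exact ⟨hu.1, hVi u hu.2 (by simpa using hu.1)⟩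
    refine le_trans ?_ (Finset.card_le_card hsub)
    rw [Finset.card_erase_of_mem (by simp)]
    have hcard : (Finset.univ.filter (fun u : U => u ∈ V)).card = Nat.card F ^ Module.finrank F V := by
      rw [← Module.natCard_eq_pow_finrank (K := F) (V := V), Nat.card_eq_fintype_card,
        Fintype.card_subtype]
    rw [hcard]
    exact Nat.sub_le_sub_right (Nat.pow_le_pow_right Nat.card_pos (by omega)) 1
  calc ∑ i ∈ Finset.Icc 1 n, (Nat.card F ^ i - 1)
      = ∑ i ∈ Finset.Icc 1 n, (Nat.card F ^ (n + 1 - i) - 1) := by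
        refine Finset.sum_nbij' (fun i => n + 1 - i) (fun i => n + 1 - i) ?_ ?_ ?_ ?_ ?_
        · intro i hi; rw [Finset.mem_Icc] at hi ⊢; omega
        · intro i hi; rw [Finset.mem_Icc] at hi ⊢; omega
        · intro i hi; rw [Finset.mem_Icc] at hi; omega
        · intro i hi; rw [Finset.mem_Icc] at hi; omega
        · intro i hi; rw [Finset.mem_Icc] at hi
          rw [show n + 1 - (n + 1 - i) = i by omega]
    _ ≤ ∑ i ∈ Finset.Icc 1 n, ∑ u : U, (if u ≠ 0 ∧ i ≤ colength F (u : O) then 1 else 0) :=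
        Finset.sum_le_sum hcount
    _ = ∑ u : U, ∑ i ∈ Finset.Icc 1 n, (if u ≠ 0 ∧ i ≤ colength F (u : O) then 1 else 0) :=
        Finset.sum_comm
    _ ≤ ∑ u : U, if u = 0 then 0 else colength F (u : O) := by
        refine Finset.sum_le_sum fun u _ => ?_
        by_cases hu : u = 0
        · simp [hu]
        · simp only [hu, ne_eq, not_false_eq_true, true_and, if_false]
          rw [Finset.sum_boole, Nat.cast_id]
          calc _ ≤ (Finset.Icc 1 (colength F (u : O))).card := by
                refine Finset.card_le_card fun i hi => ?_
                simp only [Finset.mem_filter, Finset.mem_Icc] at hi ⊢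
                exact ⟨hi.1.1, hi.2⟩
            _ = _ := by simp

end Colength

/-! ### Linear growth and the Bézout inequality -/

section LinearGrowth

variable {F L : Type*} [Field F] [Field L] [Algebra F L]

/-- A multiplicative family of finite dimensional subspaces of `L` of dimension at most
`d * m + c`, the quotients of whose elements of equal index exhaust `L`. -/
structure IsLinearGrowthFiltration (W : ℕ → Submodule F L) (d c : ℕ) : Prop where
  one_mem : (1 : L) ∈ W 0
  mul_mem : ∀ {i j : ℕ} {x y : L}, x ∈ W i → y ∈ W j → x * y ∈ W (i + j)
  finite : ∀ m, Module.Finite F (W m)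
  finrank_le : ∀ m, Module.finrank F (W m) ≤ d * m + c
  exists_denominator : ∀ x : L, ∃ m, ∃ w ∈ W m, w ≠ 0 ∧ x * w ∈ W m

namespace IsLinearGrowthFiltration

variable {W : ℕ → Submodule F L} {d c : ℕ}

theorem pow_mem (hW : IsLinearGrowthFiltration W d c) {m : ℕ} {x : L} (hx : x ∈ W m) (k : ℕ) :
    x ^ k ∈ W (m * k) := by
  induction k with
  | zero => simpa using hW.one_mem
  | succ k ih => rw [pow_succ, Nat.mul_succ]; exact hW.mul_mem ih hx

theorem exists_common_denominator (hW : IsLinearGrowthFiltration W d c) {κ : Type*}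
    (s : Finset κ) (u : κ → L) : ∃ m, ∃ w ∈ W m, w ≠ 0 ∧ ∀ k ∈ s, u k * w ∈ W m := by
  classical
  induction s using Finset.induction_on with
  | empty => exact ⟨0, 1, hW.one_mem, one_ne_zero, by simp⟩
  | insert k s hk ih =>
    obtain ⟨m, w, hw, hw0, hws⟩ := ih
    obtain ⟨m', w', hw', hw0', hk'⟩ := hW.exists_denominator (u k)
    refine ⟨m + m', w * w', hW.mul_mem hw hw', mul_ne_zero hw0 hw0', fun l hl => ?_⟩
    rcases Finset.mem_insert.1 hl with rfl | hl
    · have := hW.mul_mem hw hk'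
      rwa [show u l * (w * w') = w * (u l * w') by ring]
    · have := hW.mul_mem (hws l hl) hw'
      rwa [← mul_assoc]

/-- Modulo `a` only the terms with `j = 0` survive, so they vanish by independence; cancelling one
factor `a` then shortens the relation. -/
theorem eq_zero_of_sum_mul_pow_eq_zero {κ : Type*} [Fintype κ] (B : Subalgebra F L) {a : L}
    (ha : a ∈ B) (ha0 : a ≠ 0) (u : κ → L) (hu : ∀ k, u k ∈ B)
    (hind : ∀ t : κ → F, ∀ b ∈ B, ∑ k, t k • u k = a * b → t = 0) (K : ℕ) (t : ℕ → κ → F)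
    (ht : ∑ j ∈ Finset.range K, ∑ k, t j k • (u k * a ^ j) = 0) : ∀ j < K, t j = 0 := by
  induction K generalizing t with
  | zero => intro j hj; omega
  | succ K ih =>
    have hmul : ∑ j ∈ Finset.range K, ∑ k, t (j + 1) k • (u k * a ^ (j + 1)) =
        a * ∑ j ∈ Finset.range K, ∑ k, t (j + 1) k • (u k * a ^ j) := by
      rw [Finset.mul_sum]
      refine Finset.sum_congr rfl fun j _ => ?_
      rw [Finset.mul_sum]
      refine Finset.sum_congr rfl fun k _ => ?_
      rw [mul_smul_comm]
      congr 1
      ring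
    rw [Finset.sum_range_succ', hmul] at ht
    simp only [pow_zero, mul_one] at ht
    have h0 : t 0 = 0 := by
      refine hind (t 0) (-∑ j ∈ Finset.range K, ∑ k, t (j + 1) k • (u k * a ^ j)) ?_ ?_
      · exact B.neg_mem (B.sum_mem fun j _ => B.sum_mem fun k _ =>
          B.smul_mem (B.mul_mem (hu k) (B.pow_mem ha j)) _)
      · linear_combination ht
    rw [h0] at ht
    simp only [Pi.zero_apply, zero_smul, Finset.sum_const_zero, add_zero, mul_eq_zero, ha0,
      false_or] at ht
    intro j hj
    rcases j with _ | j
    · exact h0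
    · exact ih (fun j => t (j + 1)) ht j (by omega)

/-- Elements of a subalgebra that are independent modulo `a` are at most `d * D` in number if `a`
is a quotient of elements of `W D`. -/
theorem card_le (hW : IsLinearGrowthFiltration W d c) {κ : Type*} [Fintype κ]
    (B : Subalgebra F L) {a T : L} {D : ℕ} (ha : a ∈ B) (ha0 : a ≠ 0) (hT : T ∈ W D) (hT0 : T ≠ 0)
    (haT : a * T ∈ W D) (u : κ → L) (hu : ∀ k, u k ∈ B)
    (hind : ∀ t : κ → F, ∀ b ∈ B, ∑ k, t k • u k = a * b → t = 0) :
    Fintype.card κ ≤ d * D := by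
  obtain ⟨m, w, hw, hw0, hws⟩ := hW.exists_common_denominator Finset.univ u
  -- The products `u k * a ^ j` with `j < K` are independent, and the common denominator `w * T ^ K`
  -- moves them all into `W (m + D * K)`.
  have key : ∀ K : ℕ, K * Fintype.card κ ≤ d * (m + D * K) + c := by
    intro K
    let y : Fin K × κ → L := fun p => (u p.2 * a ^ (p.1 : ℕ)) * (w * T ^ K)
    have hy : ∀ p, y p ∈ W (m + D * K) := by
      rintro ⟨j, k⟩
      have h1 := hW.mul_mem (hws k (Finset.mem_univ k))
        (hW.mul_mem (hW.pow_mem haT j) (hW.pow_mem hT (K - j)))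
      have h2 : D * (j : ℕ) + D * (K - j) = D * K := by
        rw [← Nat.mul_add]; congr 1; omega
      rw [h2] at h1
      have h3 : T ^ K = T ^ (j : ℕ) * T ^ (K - j) := by
        rw [← pow_add]; congr 1; omega
      have h4 : y (j, k) = u k * w * ((a * T) ^ (j : ℕ) * T ^ (K - (j : ℕ))) := by
        simp only [y]
        rw [h3]; ring
      rwa [h4]
    have hli : LinearIndependent F y := by
      rw [Fintype.linearIndependent_iff]
      intro t ht
      have h0 : w * T ^ K ≠ 0 := mul_ne_zero hw0 (pow_ne_zero _ hT0)
      have h1 : ∑ j ∈ Finset.range K, ∑ k,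
          (if hj : j < K then t (⟨j, hj⟩, k) else 0) • (u k * a ^ j) = 0 := by
        refine (mul_eq_zero.1 ?_).resolve_right h0
        rw [← ht, Finset.sum_mul, Fintype.sum_prod_type, Finset.sum_range]
        refine Finset.sum_congr rfl fun j _ => ?_
        rw [Finset.sum_mul]
        refine Finset.sum_congr rfl fun k _ => ?_
        simp [y]
      have h2 := eq_zero_of_sum_mul_pow_eq_zero B ha ha0 u hu hind K _ h1
      rintro ⟨j, k⟩
      have h3 := congrFun (h2 j j.2) k
      simpa using h3
    have hfin := hW.finite (m + D * K)
    have hli' : LinearIndependent F (fun p => (⟨y p, hy p⟩ : W (m + D * K))) :=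
      LinearIndependent.of_comp (W (m + D * K)).subtype hli
    have h1 := hli'.fintype_card_le_finrank
    rw [Fintype.card_prod, Fintype.card_fin] at h1
    exact h1.trans (hW.finrank_le _)
  by_contra hlt
  -- With `card κ ≥ d * D + 1`, the bound `key K` forces `K ≤ d * m + c`; this is the first `K` that
  -- violates it.
  have h1 := key (d * m + c + 1)
  have h2 : d * D + 1 ≤ Fintype.card κ := by omega
  have h3 := Nat.mul_le_mul_left (d * m + c + 1) h2
  nlinarith

/-- Lifts to `B` of an independent family in the quotient are independent modulo `a`, so `card_le`
bounds the size of every such family. -/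
theorem finiteColength (hW : IsLinearGrowthFiltration W d c) (B : Subalgebra F L) :
    FiniteColength F B := by
  intro a ha0
  have ha0' : (a : L) ≠ 0 := by simpa using ha0
  obtain ⟨D, T, hT, hT0, haT⟩ := hW.exists_denominator (a : L)
  rw [← Module.rank_lt_aleph0_iff]
  refine lt_of_le_of_lt (rank_le (n := d * D) fun s hs => ?_) (Cardinal.natCast_lt_aleph0)
  choose u hu using fun x : B ⧸ Ideal.span {a} => Ideal.Quotient.mk_surjective x
  have := hW.card_le (κ := s) B a.2 ha0' hT hT0 haT (fun k => (u k : L)) (fun k => (u k).2) ?_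
  · simpa using this
  · intro t b hb hab
    have h1 : ∑ k : s, t k • u (k : B ⧸ Ideal.span {a}) = a * ⟨b, hb⟩ := by
      apply Subtype.ext
      simpa using hab
    have h2 := congrArg (Ideal.Quotient.mkₐ F (Ideal.span {a})) h1
    rw [map_sum] at h2
    simp only [map_smul, map_mul] at h2
    have h3 : (Ideal.Quotient.mkₐ F (Ideal.span {a})) a = 0 :=
      Ideal.Quotient.eq_zero_iff_mem.2 (Ideal.mem_span_singleton_self a)
    rw [h3, zero_mul] at h2
    funext k
    refine Fintype.linearIndependent_iff.1 hs t ?_ k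
    rw [← h2]
    refine Finset.sum_congr rfl fun k _ => ?_
    congr 1
    exact (hu k).symm

end IsLinearGrowthFiltration

theorem dvd_or_dvd_of_mem_or_inv_mem (O : Subalgebra F L) (hO : ∀ x : L, x ∈ O ∨ x⁻¹ ∈ O)
    (x y : O) : x ∣ y ∨ y ∣ x := by
  by_cases hx : (x : L) = 0
  · right
    rw [show x = 0 from Subtype.ext hx]
    exact dvd_zero y
  by_cases hy : (y : L) = 0
  · left
    rw [show y = 0 from Subtype.ext hy]
    exact dvd_zero x
  rcases hO ((y : L) / x) with h | h
  · exact Or.inl ⟨⟨_, h⟩, Subtype.ext (by simp; field_simp)⟩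
  · exact Or.inr ⟨⟨_, h⟩, Subtype.ext (by simp; field_simp)⟩

theorem inv_mem_of_isUnit (O : Subalgebra F L) {x : L} {hx : x ∈ O}
    (h : IsUnit (⟨x, hx⟩ : O)) : x ≠ 0 ∧ x⁻¹ ∈ O := by
  obtain ⟨y, hy⟩ := h.exists_right_inv
  have hxy : x * y = 1 := by simpa using congrArg Subtype.val hy
  exact ⟨left_ne_zero_of_mul_eq_one hxy, by rw [inv_eq_of_mul_eq_one_right hxy]; exact y.2⟩

/-- Multiplication by a high power of an element of the maximal ideal of a valuation ring of `L`
brings a given element of `L` into the ring. -/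
theorem IsLinearGrowthFiltration.eventually_mul_pow_mem {W : ℕ → Submodule F L} {d c : ℕ}
    (hW : IsLinearGrowthFiltration W d c) (O : Subalgebra F L) (hO : ∀ x : L, x ∈ O ∨ x⁻¹ ∈ O)
    {g : L} (hg : g ∈ O) (hgu : ¬ IsUnit (⟨g, hg⟩ : O)) (x : L) :
    ∀ᶠ s : ℕ in Filter.atTop, x * g ^ s ∈ O := by
  by_cases hx : x ∈ O
  · exact Filter.Eventually.of_forall fun s => O.mul_mem hx (O.pow_mem hg s)
  have hx0 : x ≠ 0 := fun h => hx (h ▸ O.zero_mem)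
  have hxi := (hO x).resolve_left hx
  filter_upwards [Filter.eventually_gt_atTop (colength F (⟨x⁻¹, hxi⟩ : O))] with s hs
  obtain ⟨y, hy⟩ := dvd_pow_of_colength_lt (hW.finiteColength O)
    (dvd_or_dvd_of_mem_or_inv_mem O hO) (b := ⟨x⁻¹, hxi⟩)
    (fun h => inv_ne_zero hx0 (congrArg Subtype.val h)) hgu hs
  have hy' : g ^ s = x⁻¹ * y := by simpa using congrArg Subtype.val hy
  rw [hy', ← mul_assoc, mul_inv_cancel₀ hx0, one_mul]
  exact y.2

/-- The sum of the colengths of `a` in finitely many valuation rings that can be told apart by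
elements `g i` is bounded by `d` times the degree of `a`. -/
theorem IsLinearGrowthFiltration.sum_colength_le {W : ℕ → Submodule F L} {d c : ℕ}
    (hW : IsLinearGrowthFiltration W d c) {ι : Type*} [Fintype ι] (O : ι → Subalgebra F L)
    (hO : ∀ i, ∀ x : L, x ∈ O i ∨ x⁻¹ ∈ O i) (g : ι → L) (hg : ∀ i j, g i ∈ O j)
    (hgu : ∀ i, IsUnit (⟨g i, hg i i⟩ : O i))
    (hgn : ∀ i j, i ≠ j → ¬ IsUnit (⟨g i, hg i j⟩ : O j))
    {a T : L} {D : ℕ} (ha : ∀ i, a ∈ O i) (ha0 : a ≠ 0) (hT : T ∈ W D) (hT0 : T ≠ 0)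
    (haT : a * T ∈ W D) : ∑ i, colength F (⟨a, ha i⟩ : O i) ≤ d * D := by
  classical
  have hfin : ∀ i, Module.Finite F (O i ⧸ Ideal.span {(⟨a, ha i⟩ : O i)}) := fun i =>
    hW.finiteColength (O i) _ fun h => ha0 (congrArg Subtype.val h)
  have hfree : ∀ i, Module.Free F (O i ⧸ Ideal.span {(⟨a, ha i⟩ : O i)}) := fun i =>
    Module.Free.of_divisionRing F _
  let b : ∀ i, Module.Basis (Fin (colength F (⟨a, ha i⟩ : O i))) F
      (O i ⧸ Ideal.span {(⟨a, ha i⟩ : O i)}) := fun i => Module.finBasis F _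
  choose v hv using fun i k => Ideal.Quotient.mk_surjective (b i k)
  let κ := (i : ι) × Fin (colength F (⟨a, ha i⟩ : O i))
  have hcard : Fintype.card κ = ∑ i, colength F (⟨a, ha i⟩ : O i) := by
    simp [κ]
  -- Approximation: a high power of `g i` makes the lifts from `O i` divisible by `a` in every other
  -- ring, while `g i` stays a unit in `O i`. The modified lifts then lie in the intersection `B` of
  -- all the rings.
  have hev : ∀ᶠ s : ℕ in Filter.atTop, ∀ (p : κ) (j : ι), p.1 ≠ j →
      ((v p.1 p.2 : L) / a) * g p.1 ^ s ∈ O j := by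
    rw [Filter.eventually_all]
    intro p
    rw [Filter.eventually_all]
    intro j
    by_cases h : p.1 = j
    · exact Filter.Eventually.of_forall fun s h' => absurd h h'
    · filter_upwards [hW.eventually_mul_pow_mem (O j) (hO j) (hg p.1 j) (hgn _ _ h)
        ((v p.1 p.2 : L) / a)] with s hs _ using hs
  obtain ⟨s, hs⟩ := hev.exists
  let B : Subalgebra F L := ⨅ i, O i
  have hB : ∀ {x : L}, x ∈ B ↔ ∀ i, x ∈ O i := fun {x} => Algebra.mem_iInf
  let u : κ → L := fun p => (v p.1 p.2 : L) * g p.1 ^ s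
  have hua : ∀ p, u p = a * ((v p.1 p.2 : L) / a * g p.1 ^ s) := fun p => by
    simp only [u]; field_simp
  rw [← hcard]
  refine hW.card_le B (hB.2 ha) ha0 hT hT0 haT u (fun p => hB.2 fun j => ?_) ?_
  · by_cases h : p.1 = j
    · subst h
      exact (O p.1).mul_mem (v p.1 p.2).2 ((O p.1).pow_mem (hg _ _) s)
    · rw [hua]
      exact (O j).mul_mem (ha j) (hs p j h)
  · intro t y hy hty
    have hzero : ∀ i k, t ⟨i, k⟩ = 0 := by
      intro i
      obtain ⟨hg0, hginv⟩ := inv_mem_of_isUnit (O i) (hgu i)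
      have hgs0 : g i ^ s ≠ 0 := pow_ne_zero s hg0
      -- In `O i` the terms from the other rings are multiples of `a`. Dividing by the unit `g i ^
      -- s` leaves a relation modulo `a` among the basis of `O i / a`.
      rw [Fintype.sum_sigma, ← Finset.add_sum_erase _ _ (Finset.mem_univ i)] at hty
      have h1 : ∑ j ∈ Finset.univ.erase i, ∑ k, t ⟨j, k⟩ • u ⟨j, k⟩ =
          a * ∑ j ∈ Finset.univ.erase i, ∑ k, t ⟨j, k⟩ • ((v j k : L) / a * g j ^ s) := by
        simp only [Finset.mul_sum]
        refine Finset.sum_congr rfl fun j _ => Finset.sum_congr rfl fun k _ => ?_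
        rw [hua, mul_smul_comm]
      set z := ∑ j ∈ Finset.univ.erase i, ∑ k, t ⟨j, k⟩ • ((v j k : L) / a * g j ^ s) with hz
      have hzO : z ∈ O i := (O i).sum_mem fun j hj => (O i).sum_mem fun k _ =>
        (O i).smul_mem (hs ⟨j, k⟩ i (Finset.ne_of_mem_erase hj)) _
      have h2 : ∑ k, t ⟨i, k⟩ • u ⟨i, k⟩ = (∑ k, t ⟨i, k⟩ • (v i k : L)) * g i ^ s := by
        rw [Finset.sum_mul]
        exact Finset.sum_congr rfl fun k _ => (smul_mul_assoc _ _ _).symm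
      have hw : (y - z) * (g i)⁻¹ ^ s ∈ O i :=
        (O i).mul_mem ((O i).sub_mem (hB.1 hy i) hzO) ((O i).pow_mem hginv s)
      have h3 : ∑ k, t ⟨i, k⟩ • (v i k : L) = a * ((y - z) * (g i)⁻¹ ^ s) := by
        rw [h1, h2] at hty
        rw [inv_pow]
        field_simp
        linear_combination hty
      have h4 : ∑ k, t ⟨i, k⟩ • v i k = (⟨a, ha i⟩ : O i) * ⟨_, hw⟩ := by
        apply Subtype.ext
        simpa using h3
      have h5 := congrArg (Ideal.Quotient.mkₐ F (Ideal.span {(⟨a, ha i⟩ : O i)})) h4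
      rw [map_sum, map_mul] at h5
      simp only [map_smul] at h5
      have h6 : (Ideal.Quotient.mkₐ F (Ideal.span {(⟨a, ha i⟩ : O i)})) ⟨a, ha i⟩ = 0 :=
        Ideal.Quotient.eq_zero_iff_mem.2 (Ideal.mem_span_singleton_self _)
      rw [h6, zero_mul] at h5
      refine Fintype.linearIndependent_iff.1 (b i).linearIndependent (fun k => t ⟨i, k⟩) ?_
      rw [← h5]
      refine Finset.sum_congr rfl fun k _ => ?_
      congr 1
      exact (hv i k).symm
    funext p
    exact hzero p.1 p.2

end LinearGrowth

/-! ### Valuation rings dominating the local ring of a point -/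

section Places

variable {F L : Type*} [Field F] [Field L] [Algebra F L]

theorem isHomogeneous_aeval_mul {σ R A : Type*} [Fintype σ] [CommSemiring R] [CommSemiring A]
    [Algebra R A] {f : MvPolynomial σ R} {m : ℕ} (hf : f.IsHomogeneous m) (c : A) (v : σ → A) :
    MvPolynomial.aeval (fun i => c * v i) f = c ^ m * MvPolynomial.aeval v f := by
  rw [MvPolynomial.aeval_def, MvPolynomial.aeval_def, MvPolynomial.eval₂_eq',
    MvPolynomial.eval₂_eq', Finset.mul_sum]
  refine Finset.sum_congr rfl fun e he => ?_
  have hdeg : ∑ i, e i = m := by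
    simpa [Finsupp.weight_apply, Finsupp.sum_fintype] using
      hf (MvPolynomial.mem_support_iff.mp he)
  simp only [mul_pow, Finset.prod_mul_distrib, Finset.prod_pow_eq_pow_sum, hdeg]
  ring

/-- The linear form with given coefficients. -/
noncomputable def linForm (F : Type*) [Field F] (σ : Type*) [Fintype σ] :
    (σ → F) →ₗ[F] MvPolynomial σ F :=
  Fintype.linearCombination F MvPolynomial.X

theorem linForm_apply {σ : Type*} [Fintype σ] (v : σ → F) :
    linForm F σ v = ∑ i, v i • MvPolynomial.X i := rfl

theorem linForm_isHomogeneous {σ : Type*} [Fintype σ] (v : σ → F) :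
    (linForm F σ v).IsHomogeneous 1 := by
  rw [linForm_apply]
  refine MvPolynomial.IsHomogeneous.sum _ _ _ fun i _ => ?_
  rw [MvPolynomial.smul_eq_C_mul]
  exact MvPolynomial.isHomogeneous_C_mul_X _ _

theorem aeval_linForm {σ A : Type*} [Fintype σ] [CommRing A] [Algebra F A] (v : σ → F) (p : σ → A) :
    MvPolynomial.aeval p (linForm F σ v) = ∑ i, algebraMap F A (v i) * p i := by
  simp [linForm_apply, Algebra.smul_def]

variable {σ : Type*}

/-- A form of degree `N` that agrees with a given polynomial of degree at most `N` where the linear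
form `l` takes the value one. -/
noncomputable def homogenizeAt (l f : MvPolynomial σ F) : MvPolynomial σ F :=
  ∑ k ∈ Finset.range (f.totalDegree + 1),
    MvPolynomial.homogeneousComponent k f * l ^ (f.totalDegree - k)

theorem homogenizeAt_isHomogeneous {l : MvPolynomial σ F} (hl : l.IsHomogeneous 1)
    (f : MvPolynomial σ F) : (homogenizeAt l f).IsHomogeneous f.totalDegree := by
  refine MvPolynomial.IsHomogeneous.sum _ _ _ fun k hk => ?_
  have h := (MvPolynomial.homogeneousComponent_isHomogeneous k f).mul
    (hl.pow (f.totalDegree - k))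
  rwa [one_mul, show k + (f.totalDegree - k) = f.totalDegree by
    have := Finset.mem_range.1 hk; omega] at h

theorem aeval_homogenizeAt {A : Type*} [CommRing A] [Algebra F A] (l f : MvPolynomial σ F)
    (v : σ → A) (hv : MvPolynomial.aeval v l = 1) :
    MvPolynomial.aeval v (homogenizeAt l f) = MvPolynomial.aeval v f := by
  conv_rhs => rw [← MvPolynomial.sum_homogeneousComponent f]
  simp [homogenizeAt, map_sum, hv]

/-- For a point `p` of the projective variety with homogeneous coordinate functions `φ (X i)`, there
is a valuation ring of `L` that dominates the local ring at `p`. -/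
theorem exists_valuationRing_dominating [Fintype σ] (φ : MvPolynomial σ F →ₐ[F] L) (p : σ → F)
    (hp : ∀ m : ℕ, ∀ f : MvPolynomial σ F, f.IsHomogeneous m → φ f = 0 → MvPolynomial.aeval p f = 0)
    (hp0 : p ≠ 0) :
    ∃ O : Subalgebra F L, (∀ x : L, x ∈ O ∨ x⁻¹ ∈ O) ∧
      ∀ m : ℕ, ∀ f g : MvPolynomial σ F, f.IsHomogeneous m → g.IsHomogeneous m →
        MvPolynomial.aeval p g ≠ 0 →
        ∃ h : φ f / φ g ∈ O, IsUnit (⟨φ f / φ g, h⟩ : O) ↔ MvPolynomial.aeval p f ≠ 0 := by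
  classical
  obtain ⟨l, hl, hpl⟩ : ∃ l : MvPolynomial σ F, l.IsHomogeneous 1 ∧ MvPolynomial.aeval p l = 1 := by
    obtain ⟨i, hi⟩ := Function.ne_iff.1 hp0
    refine ⟨linForm F σ (Pi.single i (p i)⁻¹), linForm_isHomogeneous _, ?_⟩
    rw [aeval_linForm, Finset.sum_eq_single i]
    · simpa using inv_mul_cancel₀ hi
    · intro j _ hj; simp [hj]
    · simp
  have hφl : φ l ≠ 0 := fun h => one_ne_zero (hpl.symm.trans (hp 1 l hl h))
  -- `ψ` dehomogenizes by `l`; since `l` takes the value one at `p`, its kernel consists of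
  -- polynomials vanishing at `p`.
  let ψ : MvPolynomial σ F →ₐ[F] L :=
    MvPolynomial.aeval fun i => (φ l)⁻¹ * φ (MvPolynomial.X i)
  have hψ : ∀ m : ℕ, ∀ f : MvPolynomial σ F, f.IsHomogeneous m → ψ f = (φ l)⁻¹ ^ m * φ f := by
    intro m f hf
    simp only [ψ]
    rw [isHomogeneous_aeval_mul hf]
    congr 1
    exact (DFunLike.congr_fun (MvPolynomial.aeval_unique φ) f).symm
  have hψl : ψ l = 1 := by rw [hψ 1 l hl]; field_simp
  have hker : ∀ f : MvPolynomial σ F, ψ f = 0 → MvPolynomial.aeval p f = 0 := by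
    intro f hf
    have hh := homogenizeAt_isHomogeneous hl f
    have h1 : ψ (homogenizeAt l f) = ψ f := aeval_homogenizeAt l f _ hψl
    rw [hψ _ _ hh, hf] at h1
    have h2 := (mul_eq_zero.1 h1).resolve_left (pow_ne_zero _ (inv_ne_zero hφl))
    rw [← aeval_homogenizeAt l f p hpl]
    exact hp _ _ hh h2
  let I : Ideal ψ.range := Ideal.map ψ.rangeRestrict
    (RingHom.ker (MvPolynomial.aeval p : MvPolynomial σ F →ₐ[F] F))
  have hI : I ≠ ⊤ := by
    rw [Ideal.ne_top_iff_one]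
    intro h1
    obtain ⟨f, hf, hf1⟩ := (Ideal.mem_map_iff_of_surjective _ ψ.rangeRestrict_surjective).1 h1
    have hf1' : ψ f = 1 := congrArg Subtype.val hf1
    have h2 := hker (f - 1) (by rw [map_sub, hf1', map_one, sub_self])
    rw [map_sub, map_one, (RingHom.mem_ker.1 hf : MvPolynomial.aeval p f = 0)] at h2
    simp at h2
  obtain ⟨B, hAB, hIB⟩ := Ideal.image_subset_nonunits_valuationSubring
    (A := ψ.range.toSubring) I hI
  have hψB : ∀ f, ψ f ∈ B := fun f => hAB ⟨f, rfl⟩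
  have hnon : ∀ f, MvPolynomial.aeval p f = 0 → ψ f ∈ B.nonunits := fun f hf =>
    hIB ⟨⟨ψ f, ⟨f, rfl⟩⟩, Ideal.mem_map_of_mem ψ.rangeRestrict (RingHom.mem_ker.2 hf), rfl⟩
  -- As `f - f(p)` maps to a nonunit, `ψ f` being a nonunit would make the nonzero constant `f(p)` a
  -- nonunit.
  have hinv : ∀ f, MvPolynomial.aeval p f ≠ 0 → ψ f ≠ 0 ∧ (ψ f)⁻¹ ∈ B := by
    intro f hf
    have hf0 : ψ f ≠ 0 := fun h => hf (hker f h)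
    refine ⟨hf0, by_contra fun h => ?_⟩
    have h1 : ψ f ∈ B.nonunits := B.mem_nonunits_iff_or.2 (Or.inr h)
    have h2 := hnon (f - MvPolynomial.C (MvPolynomial.aeval p f)) (by simp)
    have h3 := B.nonunits.sub_mem h1 h2
    rw [map_sub, sub_sub_cancel, ← MvPolynomial.algebraMap_eq, AlgHom.commutes] at h3
    rcases B.mem_nonunits_iff_or.1 h3 with h4 | h4
    · exact hf (by simpa using h4)
    · refine h4 ?_
      rw [← map_inv₀, ← ψ.commutes]
      exact hψB _
  let O : Subalgebra F L :=
    { B.toSubring with algebraMap_mem' := fun r => ψ.commutes r ▸ hψB (algebraMap _ _ r) }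
  have hO : ∀ x, x ∈ O ↔ x ∈ B := fun x => Iff.rfl
  refine ⟨O, fun x => B.mem_or_inv_mem x, fun m f g hf hg hpg => ?_⟩
  have hfg : φ f / φ g = ψ f * (ψ g)⁻¹ := by
    rw [hψ m f hf, hψ m g hg]
    have := pow_ne_zero m (inv_ne_zero hφl)
    rw [mul_inv, mul_mul_mul_comm, mul_inv_cancel₀ this, one_mul, div_eq_mul_inv]
  obtain ⟨hg0, hginv⟩ := hinv g hpg
  refine ⟨hfg ▸ B.mul_mem _ _ (hψB f) hginv, ?_⟩
  constructor
  · intro hu hpf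
    obtain ⟨h0, h1⟩ := inv_mem_of_isUnit O hu
    rw [hfg] at h0 h1
    rcases B.mem_nonunits_iff_or.1 (hnon f hpf) with h | h
    · exact h0 (by rw [h, zero_mul])
    · refine h ?_
      have h2 := B.mul_mem _ _ h1 hginv
      rwa [mul_inv, inv_inv, mul_assoc, mul_inv_cancel₀ hg0, mul_one] at h2
  · intro hpf
    obtain ⟨hf0, hfinv⟩ := hinv f hpf
    have h1 : ψ g * (ψ f)⁻¹ ∈ O := B.mul_mem _ _ (hψB g) hfinv
    refine IsUnit.of_mul_eq_one (⟨_, h1⟩ : O) (Subtype.ext ?_)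
    simp only [hfg, MulMemClass.mk_mul_mk, OneMemClass.coe_one]
    field_simp

open Classical in
theorem sum_le_sum_colength_of_injective {O E : Type*} [CommRing O] [IsDomain O] [Algebra F O]
    [Finite F] (h : FiniteColength F O) (htot : ∀ x y : O, x ∣ y ∨ y ∣ x) [AddCommGroup E]
    [Module F E] [Fintype E] (e : E →ₗ[F] O) (he : Function.Injective e) (H : Submodule F E)
    (hH : ∀ x ∈ H, ¬ IsUnit (e x)) :
    ∑ i ∈ Finset.Icc 1 (Module.finrank F H), (Nat.card F ^ i - 1) ≤
      ∑ x ∈ Finset.univ.erase (0 : E), colength F (e x) := by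
  let eq := Submodule.equivMapOfInjective e he H
  have hfin : Finite (H.map e) := Finite.of_equiv _ eq.toEquiv
  have : Fintype (H.map e) := Fintype.ofFinite _
  have h1 := sum_le_sum_colength h htot (H.map e) (by
    rintro _ ⟨x, hx, rfl⟩
    exact hH x hx)
  rw [← eq.finrank_eq] at h1
  refine h1.trans ?_
  rw [← Equiv.sum_comp eq.toEquiv]
  calc _ = ∑ x : H, if (x : E) = 0 then 0 else colength F (e x) := by
        refine Finset.sum_congr rfl fun x _ => ?_
        have h2 : eq.toEquiv x = 0 ↔ (x : E) = 0 := by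
          simp [eq]
        simp only [h2]
        rfl
    _ = ∑ x ∈ Finset.univ.filter (· ∈ H), if x = 0 then 0 else colength F (e x) := by
        rw [Finset.sum_subtype (p := (· ∈ H)) _ (by simp)]
    _ ≤ ∑ x : E, if x = 0 then 0 else colength F (e x) :=
        Finset.sum_le_sum_of_subset (Finset.filter_subset _ _)
    _ = _ := by
        rw [← Finset.add_sum_erase _ _ (Finset.mem_univ (0 : E))]
        simp only [if_true, zero_add]
        exact Finset.sum_congr rfl fun x hx => if_neg (Finset.ne_of_mem_erase hx)

end Places

/-! ### Zeros of the product of all linear forms -/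

section RationalPoints

open MvPolynomial

variable {F L : Type*} [Field F] [Field L] [Algebra F L] {σ : Type*} [Fintype σ]

theorem finrank_ker_dotProduct {p : σ → F} (hp : p ≠ 0) :
    Module.finrank F (LinearMap.ker
      ((aeval p : MvPolynomial σ F →ₐ[F] F).toLinearMap ∘ₗ linForm F σ)) + 1 =
      Fintype.card σ := by
  rw [Module.Dual.finrank_ker_add_one_of_ne_zero, Module.finrank_fintype_fun_eq_card]
  intro h
  obtain ⟨i, hi⟩ := Function.ne_iff.1 hp
  classical
  have h1 := LinearMap.congr_fun h (Pi.single i 1)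
  simp only [LinearMap.comp_apply, AlgHom.toLinearMap_apply, LinearMap.zero_apply] at h1
  rw [aeval_linForm, Finset.sum_eq_single i] at h1
  · exact hi (by simpa using h1)
  · intro j _ hj; simp [hj]
  · simp

/-- The colength of the product of all nonzero linear forms at a rational point. -/
theorem sum_le_colength_linForms [Finite F] [Fintype (σ → F)] [DecidableEq (σ → F)]
    (φ : MvPolynomial σ F →ₐ[F] L)
    (hφ : ∀ v : σ → F, v ≠ 0 → φ (linForm F σ v) ≠ 0) {O : Subalgebra F L}
    (hO : ∀ x : L, x ∈ O ∨ x⁻¹ ∈ O) (hfin : FiniteColength F O) {p : σ → F} (hp0 : p ≠ 0)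
    (hunit : ∀ m : ℕ, ∀ f g : MvPolynomial σ F, f.IsHomogeneous m → g.IsHomogeneous m →
      aeval p g ≠ 0 → ∃ h : φ f / φ g ∈ O, IsUnit (⟨φ f / φ g, h⟩ : O) ↔ aeval p f ≠ 0)
    {T : MvPolynomial σ F} {t : ℕ} (hT : T.IsHomogeneous t) (hpT : aeval p T ≠ 0) {a : L}
    (ha : a = φ (∏ v ∈ Finset.univ.erase 0, linForm F σ v) ^ t /
      φ T ^ (Finset.univ.erase (0 : σ → F)).card) (haO : a ∈ O) :
    t * ∑ i ∈ Finset.Icc 1 (Fintype.card σ - 1), (Nat.card F ^ i - 1) ≤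
      colength F (⟨a, haO⟩ : O) := by
  classical
  set Z := (Finset.univ.erase (0 : σ → F)).card with hZ
  obtain ⟨w, hw⟩ : ∃ w : σ → F, aeval p (linForm F σ w) ≠ 0 := by
    obtain ⟨i, hi⟩ := Function.ne_iff.1 hp0
    refine ⟨Pi.single i 1, ?_⟩
    rw [aeval_linForm, Finset.sum_eq_single i]
    · simpa using hi
    · intro j _ hj; simp [hj]
    · simp
  have hw0 : w ≠ 0 := by rintro rfl; simp at hw
  have hφw := hφ w hw0
  have hmem : ∀ v, φ (linForm F σ v) / φ (linForm F σ w) ∈ O := fun v =>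
    (hunit 1 _ _ (linForm_isHomogeneous v) (linForm_isHomogeneous w) hw).1
  -- Division by a linear form `w` not vanishing at `p` embeds the linear forms in `O`; those
  -- vanishing at `p` become nonunits.
  let e₀ : (σ → F) →ₗ[F] L := LinearMap.mulRight F (φ (linForm F σ w))⁻¹ ∘ₗ
    φ.toLinearMap ∘ₗ linForm F σ
  let e : (σ → F) →ₗ[F] O := e₀.codRestrict (Subalgebra.toSubmodule O) fun v => by
    simpa [e₀, div_eq_mul_inv] using hmem v
  have hecoe : ∀ v, (e v : L) = φ (linForm F σ v) / φ (linForm F σ w) := fun v => by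
    rw [div_eq_mul_inv]
    rfl
  have he0 : ∀ v, v ≠ 0 → e v ≠ 0 := fun v hv h => by
    have := hecoe v
    rw [h] at this
    exact div_ne_zero (hφ v hv) hφw this.symm
  have hinj : Function.Injective e := by
    rw [injective_iff_map_eq_zero]
    exact fun v hv => by_contra fun h => he0 v h hv
  have hlow := sum_le_sum_colength_of_injective hfin (dvd_or_dvd_of_mem_or_inv_mem O hO) e hinj
    (LinearMap.ker ((aeval p : MvPolynomial σ F →ₐ[F] F).toLinearMap ∘ₗ linForm F σ)) (by
      intro v hv hu
      obtain ⟨h, hiff⟩ :=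
        hunit 1 _ _ (linForm_isHomogeneous v) (linForm_isHomogeneous w) hw
      refine (hiff.1 ?_) hv
      convert hu using 1
      exact Subtype.ext (hecoe v).symm)
  have hrk := finrank_ker_dotProduct hp0
  rw [show Module.finrank F (LinearMap.ker
    ((aeval p : MvPolynomial σ F →ₐ[F] F).toLinearMap ∘ₗ linForm F σ)) =
      Fintype.card σ - 1 by omega] at hlow
  have hdegw : (linForm F σ w ^ (t * Z)).IsHomogeneous (t * Z) := by
    simpa using (linForm_isHomogeneous w).pow (t * Z)
  have hdegT : (T ^ Z).IsHomogeneous (t * Z) := hT.pow Z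
  obtain ⟨hm, hiff⟩ := hunit (t * Z) _ _ hdegw hdegT (by rw [map_pow]; exact pow_ne_zero _ hpT)
  have hu := hiff.2 (by rw [map_pow]; exact pow_ne_zero _ hw)
  -- Replacing the denominator `T ^ Z` by `w ^ (t * Z)` changes `a` only by a unit of `O`.
  have hprod : (⟨a, haO⟩ : O) = (∏ v ∈ Finset.univ.erase 0, e v) ^ t * ⟨_, hm⟩ := by
    apply Subtype.ext
    simp only [MulMemClass.coe_mul, SubmonoidClass.coe_pow, map_pow]
    have h1 : ((∏ v ∈ Finset.univ.erase 0, e v : O) : L) =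
        φ (∏ v ∈ Finset.univ.erase 0, linForm F σ v) / φ (linForm F σ w) ^ Z := by
      rw [map_prod, ← O.val_apply, map_prod, hZ, ← Finset.prod_const, ← Finset.prod_div_distrib]
      exact Finset.prod_congr rfl fun v _ => hecoe v
    rw [h1, ha, div_pow, ← pow_mul, mul_comm Z t, div_mul_div_cancel₀ (pow_ne_zero _ hφw)]
  have hP0 : (∏ v ∈ Finset.univ.erase 0, e v) ≠ 0 :=
    Finset.prod_ne_zero_iff.2 fun v hv => he0 v (Finset.ne_of_mem_erase hv)
  rw [hprod, colength_mul hfin (pow_ne_zero _ hP0) hu.ne_zero,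
    (colength_eq_zero_iff hfin hu.ne_zero).2 hu, colength_pow hfin hP0,
    colength_prod hfin _ _ fun v hv => he0 v (Finset.ne_of_mem_erase hv), add_zero]
  exact Nat.mul_le_mul_left t (by convert hlow)

/-- The number of rational points is bounded by counting the zeros of the product of all linear
forms. -/
theorem card_mul_sum_le [Finite F] (φ : MvPolynomial σ F →ₐ[F] L) {d c : ℕ}
    (hW : IsLinearGrowthFiltration
      (fun m => (homogeneousSubmodule σ F m).map φ.toLinearMap) d c)
    (hφ : ∀ v : σ → F, v ≠ 0 → φ (linForm F σ v) ≠ 0) {ι : Type*} [Fintype ι] (p : ι → σ → F)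
    (hp0 : ∀ i, p i ≠ 0)
    (hp : ∀ i, ∀ m : ℕ, ∀ f : MvPolynomial σ F, f.IsHomogeneous m → φ f = 0 → aeval (p i) f = 0)
    (hsep : ∀ i j, i ≠ j → ∃ h : MvPolynomial σ F, h.IsHomogeneous 1 ∧ aeval (p i) h ≠ 0 ∧
      aeval (p j) h = 0) :
    Fintype.card ι * ∑ i ∈ Finset.Icc 1 (Fintype.card σ - 1), (Nat.card F ^ i - 1) ≤
      d * (Nat.card F ^ Fintype.card σ - 1) := by
  classical
  rcases isEmpty_or_nonempty ι with hι | hι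
  · simp
  have : Fintype (σ → F) := Fintype.ofFinite _
  choose O hO hunit using fun i => exists_valuationRing_dominating φ (p i) (hp i) (hp0 i)
  have hsep' : ∀ i j, ∃ h : MvPolynomial σ F, h.IsHomogeneous 1 ∧ aeval (p i) h ≠ 0 ∧
      (i ≠ j → aeval (p j) h = 0) := by
    intro i j
    by_cases hij : i = j
    · obtain ⟨k, hk⟩ := Function.ne_iff.1 (hp0 i)
      exact ⟨X k, isHomogeneous_X F k, by simpa using hk, fun h => absurd hij h⟩
    · obtain ⟨h, h1, h2, h3⟩ := hsep i j hij
      exact ⟨h, h1, h2, fun _ => h3⟩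
  choose h hh hhi hhj using hsep'
  set t := Fintype.card ι with ht
  have htpos : 0 < t := Fintype.card_pos
  let G : ι → MvPolynomial σ F := fun i => ∏ j, h i j
  have hG : ∀ i, (G i).IsHomogeneous t := fun i => by
    simpa using IsHomogeneous.prod Finset.univ (h i) (fun _ => 1) fun j _ => hh i j
  have hGi : ∀ i, aeval (p i) (G i) ≠ 0 := fun i => by
    rw [map_prod]
    exact Finset.prod_ne_zero_iff.2 fun j _ => hhi i j
  have hGj : ∀ i j, i ≠ j → aeval (p j) (G i) = 0 := fun i j hij => by
    rw [map_prod]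
    exact Finset.prod_eq_zero (Finset.mem_univ j) (hhj i j hij)
  -- `G i` vanishes at every chosen point except `p i`, so `T` vanishes at none of them. It serves
  -- as common denominator, and the quotients `G i / T` tell the valuation rings apart.
  let T : MvPolynomial σ F := ∑ i, G i
  have hT : T.IsHomogeneous t := IsHomogeneous.sum _ _ _ fun i _ => hG i
  have hTi : ∀ i, aeval (p i) T ≠ 0 := fun i => by
    rw [map_sum, Finset.sum_eq_single i (fun j _ hj => hGj j i hj) (by simp)]
    exact hGi i
  have hφT : φ T ≠ 0 := fun h0 => hTi (Classical.arbitrary ι) (hp _ t T hT h0)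
  choose hg hgu using fun i j => hunit j t (G i) T (hG i) hT (hTi j)
  set Z := (Finset.univ.erase (0 : σ → F)).card with hZ
  have hZcard : Z = Nat.card F ^ Fintype.card σ - 1 := by
    rw [hZ, Finset.card_erase_of_mem (Finset.mem_univ _), Finset.card_univ,
      ← Nat.card_eq_fintype_card, Nat.card_fun, Nat.card_eq_fintype_card (α := σ)]
  let Q : MvPolynomial σ F := ∏ v ∈ Finset.univ.erase 0, linForm F σ v
  have hQ : Q.IsHomogeneous Z := by
    simpa [hZ] using IsHomogeneous.prod (Finset.univ.erase 0) (linForm F σ) (fun _ => 1)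
      fun v _ => linForm_isHomogeneous v
  have hφQ : φ Q ≠ 0 := by
    rw [map_prod]
    exact Finset.prod_ne_zero_iff.2 fun v hv => hφ v (Finset.ne_of_mem_erase hv)
  have hQt : (Q ^ t).IsHomogeneous (t * Z) := by rw [mul_comm]; exact hQ.pow t
  have hTZ : (T ^ Z).IsHomogeneous (t * Z) := hT.pow Z
  -- The exponents give numerator and denominator the same degree `t * Z`. The factor `t` appears in
  -- both bounds and cancels at the end.
  let a : L := φ Q ^ t / φ T ^ Z
  have haO : ∀ i, a ∈ O i := fun i => by
    obtain ⟨h1, -⟩ := hunit i (t * Z) _ _ hQt hTZ (by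
      rw [map_pow]; exact pow_ne_zero _ (hTi i))
    simpa [a] using h1
  have hup := hW.sum_colength_le O hO (fun i => φ (G i) / φ T) hg
    (fun i => (hgu i i).2 (hGi i)) (fun i j hij hu => (hgu i j).1 hu (hGj i j hij)) haO
    (div_ne_zero (pow_ne_zero _ hφQ) (pow_ne_zero _ hφT)) (T := φ (T ^ Z)) (D := t * Z)
    ⟨_, hTZ, rfl⟩ (by rw [map_pow]; exact pow_ne_zero _ hφT)
    ⟨_, hQt, by simp [a, hφT]⟩
  have hlow : ∀ i, t * ∑ i ∈ Finset.Icc 1 (Fintype.card σ - 1), (Nat.card F ^ i - 1) ≤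
      colength F (⟨a, haO i⟩ : O i) := fun i =>
    sum_le_colength_linForms φ hφ (hO i) (hW.finiteColength (O i)) (hp0 i) (hunit i) hT (hTi i)
      rfl (haO i)
  have h1 := (Finset.sum_le_sum fun i (_ : i ∈ Finset.univ) => hlow i).trans hup
  rw [Finset.sum_const, Finset.card_univ, smul_eq_mul, ← ht] at h1
  rw [← hZcard]
  refine Nat.le_of_mul_le_mul_left (c := t) ?_ htpos
  calc _ = t * (t * ∑ i ∈ Finset.Icc 1 (Fintype.card σ - 1), (Nat.card F ^ i - 1)) := rfl
    _ ≤ d * (t * Z) := h1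
    _ = _ := by ring

end RationalPoints

/-! ### Elementary estimates -/

section Arithmetic

theorem sub_one_mul_sum_pow_sub_one (q : ℕ) (hq : 1 ≤ q) (n : ℕ) :
    ((q : ℤ) - 1) * ((∑ i ∈ Finset.Icc 1 n, (q ^ i - 1) : ℕ) : ℤ) =
      (q : ℤ) ^ (n + 1) - 1 - (n + 1) * (q - 1) := by
  induction n with
  | zero => simp
  | succ n ih =>
    rw [Finset.sum_Icc_succ_top (by omega), Nat.cast_add, mul_add, ih,
      Nat.cast_sub (Nat.one_le_pow _ _ hq)]
    push_cast
    ring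

/-- This makes the error term `(q - 1) * b * d / (Z - b)`, where `b = (n + 1) * (q - 1)`, smaller
than 2 at `d = (n - 1) * q + 1`. -/
theorem two_mul_pow_sub_one_gt (q : ℤ) (hq : 2 ≤ q) (n : ℕ) (hn : 3 ≤ n) :
    ((n : ℤ) + 1) * (q - 1) * (2 + (q - 1) * (((n : ℤ) - 1) * q + 1)) < 2 * (q ^ (n + 1) - 1) := by
  induction n, hn using Nat.le_induction with
  | base =>
    -- For `n = 3` the two sides differ by exactly `2 * (q - 1) ^ 4`.
    have h : 0 < (q - 1) ^ 4 := pow_pos (by linarith) 4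
    push_cast
    nlinarith
  | succ n hn ih =>
    have hn' : (3 : ℤ) ≤ n := by exact_mod_cast hn
    have hA : (q - 1) * (2 * q) ≤ 2 + (q - 1) * (((n : ℤ) - 1) * q + 1) := by
      have h1 : 2 * q ≤ ((n : ℤ) - 1) * q + 1 := by nlinarith
      have h2 := mul_le_mul_of_nonneg_left h1 (by linarith : (0 : ℤ) ≤ q - 1)
      linarith
    set A := 2 + (q - 1) * (((n : ℤ) - 1) * q + 1) with hAdef
    have hA' : 2 + (q - 1) * ((((n + 1 : ℕ) : ℤ) - 1) * q + 1) = A + (q - 1) * q := by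
      rw [hAdef]; push_cast; ring
    have hq0 : (0 : ℤ) ≤ (q - 1) * q := mul_nonneg (by linarith) (by linarith)
    have hA0 : 0 ≤ A := by linarith
    -- From `n` to `n + 1` the left side grows at most by the factor `q`, and the right side at
    -- least by `q`.
    have hstep : ((n : ℤ) + 2) * (A + (q - 1) * q) ≤ q * ((n + 1) * A) := by
      have h1 : (n : ℤ) * A ≤ (q * (n + 1) - (n + 2)) * A :=
        mul_le_mul_of_nonneg_right (by nlinarith) hA0
      have h2 : (n : ℤ) * ((q - 1) * (2 * q)) ≤ n * A :=
        mul_le_mul_of_nonneg_left hA (by linarith)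
      have h3 : ((n : ℤ) + 2) * ((q - 1) * q) ≤ (2 * n) * ((q - 1) * q) :=
        mul_le_mul_of_nonneg_right (by linarith) hq0
      nlinarith
    have hstep' := mul_le_mul_of_nonneg_left hstep (by linarith : (0 : ℤ) ≤ q - 1)
    have ih' := mul_lt_mul_of_pos_left ih (by linarith : (0 : ℤ) < q)
    rw [hA']
    push_cast
    rw [pow_succ]
    nlinarith

/-- The bounds for the number `N` of points that follow from the inequality obtained by counting
zeros of the product of all linear forms. -/
theorem le_of_mul_sum_le (n q d N : ℕ) (hn : 3 ≤ n) (hq : 2 ≤ q)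
    (h : N * ∑ i ∈ Finset.Icc 1 n, (q ^ i - 1) ≤ d * (q ^ (n + 1) - 1)) :
    ((d : ℤ) ≥ ((n : ℤ) - 1) * q + 1 → (N : ℤ) ≤ q * ((d : ℤ) - n + 1)) ∧
    ((d : ℤ) = ((n : ℤ) - 1) * q → (N : ℤ) ≤ q * ((d : ℤ) - n + 1) + 1) := by
  have hq' : (2 : ℤ) ≤ q := by exact_mod_cast hq
  have hn' : (3 : ℤ) ≤ n := by exact_mod_cast hn
  have hS := sub_one_mul_sum_pow_sub_one q (by omega) n
  have hZ := two_mul_pow_sub_one_gt q hq' n hn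
  have h' : (N : ℤ) * ((∑ i ∈ Finset.Icc 1 n, (q ^ i - 1) : ℕ) : ℤ) ≤
      d * ((q : ℤ) ^ (n + 1) - 1) := by
    have h1 : ((q ^ (n + 1) - 1 : ℕ) : ℤ) = (q : ℤ) ^ (n + 1) - 1 := by
      rw [Nat.cast_sub (Nat.one_le_pow _ _ (by omega))]; push_cast; ring
    rw [← h1]
    exact_mod_cast h
  have h2 := mul_le_mul_of_nonneg_left h' (by linarith : (0 : ℤ) ≤ (q : ℤ) - 1)
  rw [mul_left_comm, hS] at h2
  set Z : ℤ := (q : ℤ) ^ (n + 1) - 1 with hZdef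
  set b : ℤ := ((n : ℤ) + 1) * (q - 1) with hb
  have hb0 : 0 ≤ (q - 1) * b := mul_nonneg (by linarith) (mul_nonneg (by linarith) (by linarith))
  have hm : (2 : ℤ) ≤ ((n : ℤ) - 1) * q := by nlinarith
  have hgap : (q - 1) * b * (((n : ℤ) - 1) * q + 1) < 2 * (Z - b) := by linarith
  have hgap' : (q - 1) * b ≤ Z - b := by
    have := mul_le_mul_of_nonneg_left (by linarith : (2 : ℤ) ≤ ((n : ℤ) - 1) * q + 1) hb0
    linarith
  have hZb : 0 ≤ Z - b := hb0.trans hgap'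
  constructor
  · intro hd
    by_contra hN
    obtain ⟨s, hs⟩ : ∃ s : ℤ, (d : ℤ) = ((n : ℤ) - 1) * q + 1 + s :=
      ⟨d - (((n : ℤ) - 1) * q + 1), by ring⟩
    have hs0 : 0 ≤ s := by linarith
    -- The claimed bound equals `(q - 1) * d + s + 1`. Of the excess `s + 2`, the part 2 is excluded
    -- by `hgap` and the part `s` by `hgap'`.
    have hN' : ((q : ℤ) - 1) * d + s + 2 ≤ N := by
      have : (q : ℤ) * ((d : ℤ) - n + 1) + 1 ≤ N := by omega
      linarith
    have h3 := mul_le_mul_of_nonneg_right hN' hZb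
    have h4 := mul_le_mul_of_nonneg_left hgap' hs0
    have h5 : (s + 2) * (Z - b) ≤ (q - 1) * b * d := by linarith
    rw [hs] at h5
    linarith
  · intro hd
    by_contra hN
    have hN' : ((q : ℤ) - 1) * d + 2 ≤ N := by
      have : (q : ℤ) * ((d : ℤ) - n + 1) + 2 ≤ N := by omega
      linarith
    have h3 := mul_le_mul_of_nonneg_right hN' hZb
    have h5 : 2 * (Z - b) ≤ (q - 1) * b * d := by linarith
    rw [hd] at h5
    linarith

end Arithmetic

/-! ### The affine ideal, the function field and the Hilbert function -/

section Curves

open MvPolynomial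

variable {F K : Type*} [Field F] [Field K] [Algebra F K] {n : ℕ}

theorem isClosed_setOf_vanishesAt {m : ℕ} {f : MvPolynomial (Fin (n + 1)) F}
    (hf : f.IsHomogeneous m) :
    @IsClosed _ (zariskiTopology K n) {P : ProjSpace K n | VanishesAt f P} := by
  rw [← @isOpen_compl_iff _ _ (zariskiTopology K n)]
  refine TopologicalSpace.isOpen_generateFrom_of_mem ⟨m, map (algebraMap F K) f, hf.map _, ?_⟩
  ext P
  simp [VanishesAt, aeval_map_algebraMap]

/-- An irreducible set on which a product of two forms vanishes lies in one of the two
hypersurfaces. -/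
theorem forall_vanishesAt_or_forall_vanishesAt {C : Set (ProjSpace K n)}
    (hC : @IsIrreducible _ (zariskiTopology K n) C) {m m' : ℕ}
    {f g : MvPolynomial (Fin (n + 1)) F} (hf : f.IsHomogeneous m) (hg : g.IsHomogeneous m')
    (h : ∀ P ∈ C, VanishesAt f P ∨ VanishesAt g P) :
    (∀ P ∈ C, VanishesAt f P) ∨ ∀ P ∈ C, VanishesAt g P :=
  (@isPreirreducible_iff_isClosed_union_isClosed _ (zariskiTopology K n) C).1 hC.2 _ _
    (isClosed_setOf_vanishesAt hf) (isClosed_setOf_vanishesAt hg) h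

theorem not_forall_vanishesAt_linForm {C : Set (ProjSpace K n)} (hnd : IsNondegenerate C)
    {v : Fin (n + 1) → F} (hv : v ≠ 0) : ¬ ∀ P ∈ C, VanishesAt (linForm F _ v) P := by
  intro h
  refine hnd (fun i => algebraMap F K (v i)) (fun h0 => hv ?_) fun P hP => ?_
  · funext i
    exact (algebraMap F K).injective ((congrFun h0 i).trans (map_zero _).symm)
  · have := h P hP
    rwa [VanishesAt, aeval_linForm] at this

theorem not_forall_vanishesAt_X {C : Set (ProjSpace K n)} (hnd : IsNondegenerate C)
    (i : Fin (n + 1)) : ¬ ∀ P ∈ C, VanishesAt (X i : MvPolynomial (Fin (n + 1)) F) P := by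
  have h := not_forall_vanishesAt_linForm (F := F) hnd (v := Pi.single i 1) (by
    intro h0
    simpa using congrFun h0 i)
  rwa [linForm_apply, Finset.sum_eq_single i (by intro j _ hj; simp [hj]) (by simp),
    Pi.single_eq_same, one_smul] at h

/-- The ideal of the affine part `x₀ = 1` of `C`. -/
def affineIdeal (F : Type*) {K : Type*} [Field F] [Field K] [Algebra F K] {n : ℕ}
    (C : Set (ProjSpace K n)) : Ideal (MvPolynomial (Fin (n + 1)) F) where
  carrier := {f | ∀ P ∈ C, P.rep 0 ≠ 0 → aeval (fun i => (P.rep 0)⁻¹ * P.rep i) f = 0}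
  zero_mem' := by intro P _ _; simp
  add_mem' := by
    intro f g hf hg P hP h0
    rw [map_add, hf P hP h0, hg P hP h0, add_zero]
  smul_mem' := by
    intro f g hg P hP h0
    rw [smul_eq_mul, map_mul, hg P hP h0, mul_zero]

theorem aeval_rescale_eq_zero_iff {P : ProjSpace K n} (h0 : P.rep 0 ≠ 0) {m : ℕ}
    {f : MvPolynomial (Fin (n + 1)) F} (hf : f.IsHomogeneous m) :
    aeval (fun i => (P.rep 0)⁻¹ * P.rep i) f = 0 ↔ VanishesAt f P := by
  rw [isHomogeneous_aeval_mul hf, mul_eq_zero, VanishesAt]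
  simp [h0]

/-- If `f` vanishes where `x₀ ≠ 0`, then `C` is covered by `f = 0` and `x₀ = 0`; irreducibility
selects one of them, and nondegeneracy rules out the hyperplane. -/
theorem mem_affineIdeal_iff_of_isHomogeneous {C : Set (ProjSpace K n)}
    (hC : @IsIrreducible _ (zariskiTopology K n) C) (hnd : IsNondegenerate C) {m : ℕ}
    {f : MvPolynomial (Fin (n + 1)) F} (hf : f.IsHomogeneous m) :
    f ∈ affineIdeal F C ↔ ∀ P ∈ C, VanishesAt f P := by
  constructor
  · intro h
    refine (forall_vanishesAt_or_forall_vanishesAt hC hf (isHomogeneous_X F 0) fun P hP => ?_)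
      |>.resolve_right (not_forall_vanishesAt_X hnd 0)
    by_cases h0 : P.rep 0 = 0
    · exact Or.inr (by simpa [VanishesAt] using h0)
    · exact Or.inl ((aeval_rescale_eq_zero_iff h0 hf).1 (h P hP h0))
  · exact fun h P hP h0 => (aeval_rescale_eq_zero_iff h0 hf).2 (h P hP)

theorem homogenizeAt_mem_affineIdeal_iff {C : Set (ProjSpace K n)}
    {f : MvPolynomial (Fin (n + 1)) F} :
    homogenizeAt (X 0) f ∈ affineIdeal F C ↔ f ∈ affineIdeal F C := by
  refine forall_congr' fun P => forall_congr' fun _ => forall_congr' fun h0 => ?_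
  rw [aeval_homogenizeAt]
  simp [h0]

/-- Homogenizing with `X 0` preserves membership and reduces primality to products of forms, where
irreducibility of `C` applies. -/
theorem affineIdeal_isPrime {C : Set (ProjSpace K n)}
    (hC : @IsIrreducible _ (zariskiTopology K n) C) (hnd : IsNondegenerate C) :
    (affineIdeal F C).IsPrime := by
  have hX := not_forall_vanishesAt_X (F := F) hnd 0
  refine ⟨fun htop => hX fun P hP => ?_, fun {f g} hfg => ?_⟩
  · by_contra h0
    have h0' : P.rep 0 ≠ 0 := by simpa [VanishesAt] using h0
    have h1 : (1 : MvPolynomial (Fin (n + 1)) F) ∈ affineIdeal F C := htop ▸ Submodule.mem_top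
    simpa using h1 P hP h0'
  · have hf := homogenizeAt_isHomogeneous (isHomogeneous_X F (0 : Fin (n + 1))) f
    have hg := homogenizeAt_isHomogeneous (isHomogeneous_X F (0 : Fin (n + 1))) g
    rw [← homogenizeAt_mem_affineIdeal_iff (f := f), ← homogenizeAt_mem_affineIdeal_iff (f := g),
      mem_affineIdeal_iff_of_isHomogeneous hC hnd hf, mem_affineIdeal_iff_of_isHomogeneous hC hnd hg]
    refine forall_vanishesAt_or_forall_vanishesAt hC hf hg ?_
    have hprod : homogenizeAt (X 0) f * homogenizeAt (X 0) g ∈ affineIdeal F C := by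
      intro P hP h0
      have h1 := hfg P hP h0
      have hX1 : aeval (fun i => (P.rep 0)⁻¹ * P.rep i) (X 0 : MvPolynomial (Fin (n + 1)) F) = 1 := by
        simp [h0]
      rwa [map_mul, aeval_homogenizeAt _ _ _ hX1, aeval_homogenizeAt _ _ _ hX1, ← map_mul]
    rw [mem_affineIdeal_iff_of_isHomogeneous hC hnd (hf.mul hg)] at hprod
    intro P hP
    simpa [VanishesAt] using hprod P hP

/-- The finitely many degrees before the Hilbert polynomial takes over are absorbed into the
constant. -/
theorem hilbertFunction_le {C : Set (ProjSpace K n)} {d : ℕ} (hd : HasCurveDegree F C d) :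
    ∃ c : ℕ, ∀ m, hilbertFunction F C m ≤ d * m + c := by
  obtain ⟨c, hc⟩ := hd
  obtain ⟨M, hM⟩ := Filter.eventually_atTop.1 hc
  refine ⟨c.toNat + ∑ m ∈ Finset.range M, hilbertFunction F C m, fun m => ?_⟩
  by_cases h : M ≤ m
  · have := hM m h
    zify
    have := Int.self_le_toNat c
    have : (0 : ℤ) ≤ ∑ m ∈ Finset.range M, (hilbertFunction F C m : ℤ) :=
      Finset.sum_nonneg fun _ _ => Int.natCast_nonneg _
    linarith
  · have := Finset.single_le_sum (f := fun m => hilbertFunction F C m)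
      (fun _ _ => Nat.zero_le _) (Finset.mem_range.2 (not_le.1 h))
    omega

/-- A form that vanishes at one point and not at another. -/
theorem exists_linForm_separating {v w : Fin (n + 1) → F} (hw : w ≠ 0)
    (h : ∀ c : F, v ≠ c • w) : ∃ f : MvPolynomial (Fin (n + 1)) F, f.IsHomogeneous 1 ∧
      aeval v f ≠ 0 ∧ aeval w f = 0 := by
  obtain ⟨k, hk⟩ := Function.ne_iff.1 hw
  have hk' : w k ≠ 0 := hk
  obtain ⟨l, hl⟩ := Function.ne_iff.1 (h (v k / w k))
  refine ⟨C (w k) * X l - C (w l) * X k,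
    (isHomogeneous_C_mul_X _ _).sub (isHomogeneous_C_mul_X _ _), ?_, ?_⟩
  · intro h0
    refine hl ?_
    simp only [map_sub, map_mul, aeval_C, aeval_X, Algebra.algebraMap_self, RingHom.id_apply] at h0
    rw [Pi.smul_apply, smul_eq_mul]
    field_simp
    linear_combination h0
  · simp only [map_sub, map_mul, aeval_C, aeval_X, Algebra.algebraMap_self, RingHom.id_apply]
    ring

section FunctionField

variable {C : Set (ProjSpace K n)}

/-- The homogeneous coordinate functions of a curve, divided by the first one, in its function
field. -/
noncomputable def toFunctionField (F : Type*) {K : Type*} [Field F] [Field K] [Algebra F K] {n : ℕ}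
    (C : Set (ProjSpace K n)) :
    MvPolynomial (Fin (n + 1)) F →ₐ[F] FractionRing (MvPolynomial (Fin (n + 1)) F ⧸ affineIdeal F C) :=
  (IsScalarTower.toAlgHom F (MvPolynomial (Fin (n + 1)) F ⧸ affineIdeal F C) _).comp
    (Ideal.Quotient.mkₐ F (affineIdeal F C))

theorem toFunctionField_eq_zero_iff {f : MvPolynomial (Fin (n + 1)) F} :
    toFunctionField F C f = 0 ↔ f ∈ affineIdeal F C := by
  rw [← Ideal.Quotient.eq_zero_iff_mem]
  exact IsFractionRing.to_map_eq_zero_iff (R := MvPolynomial (Fin (n + 1)) F ⧸ affineIdeal F C)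
    (K := FractionRing (MvPolynomial (Fin (n + 1)) F ⧸ affineIdeal F C))

theorem toFunctionField_X_zero : toFunctionField F C (X 0) = 1 := by
  rw [← map_one (toFunctionField F C), ← sub_eq_zero, ← map_sub, toFunctionField_eq_zero_iff]
  intro P _ h0
  simp [h0]

theorem toFunctionField_homogenizeAt (f : MvPolynomial (Fin (n + 1)) F) :
    toFunctionField F C (homogenizeAt (X 0) f) = toFunctionField F C f := by
  rw [aeval_unique (toFunctionField F C), aeval_homogenizeAt]
  rw [aeval_X, Function.comp_apply, toFunctionField_X_zero]

/-- Forms vanishing on `C` map to zero, so the image of the degree `m` forms has dimension at most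
the Hilbert function. Since `X 0` maps to one, numerator and denominator of any fraction can be
homogenized to a common degree. -/
theorem isLinearGrowthFiltration_forms [(affineIdeal F C).IsPrime] {d c : ℕ}
    (hc : ∀ m, hilbertFunction F C m ≤ d * m + c) :
    IsLinearGrowthFiltration (fun m => (homogeneousSubmodule (Fin (n + 1)) F m).map
      (toFunctionField F C).toLinearMap) d c where
  one_mem := ⟨1, isHomogeneous_one _ _, map_one (toFunctionField F C)⟩
  mul_mem := by
    rintro i j _ _ ⟨f, hf, rfl⟩ ⟨g, hg, rfl⟩
    exact ⟨f * g, IsHomogeneous.mul hf hg, map_mul (toFunctionField F C) f g⟩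
  finite m := Module.Finite.iff_fg.2 ((homogeneousSubmodule_fg _ _ m).map _)
  finrank_le m := by
    refine le_trans ?_ (hc m)
    have hfin : Module.Finite F (homogeneousSubmodule (Fin (n + 1)) F m) :=
      Module.Finite.iff_fg.2 (homogeneousSubmodule_fg _ _ m)
    let g := (toFunctionField F C).toLinearMap ∘ₗ (homogeneousSubmodule (Fin (n + 1)) F m).subtype
    have hle : vanishingForms F C m ≤ LinearMap.ker g := fun f hf =>
      toFunctionField_eq_zero_iff.2 fun P hP h0 =>
        (aeval_rescale_eq_zero_iff h0 f.2).2 (hf P hP)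
    have hrange : LinearMap.range ((vanishingForms F C m).liftQ g hle) =
        (homogeneousSubmodule (Fin (n + 1)) F m).map (toFunctionField F C).toLinearMap := by
      rw [Submodule.range_liftQ, LinearMap.range_comp, Submodule.range_subtype]
    rw [← hrange]
    exact LinearMap.finrank_range_le _
  exists_denominator x := by
    obtain ⟨a, b, hb, rfl⟩ := IsFractionRing.div_surjective
      (A := MvPolynomial (Fin (n + 1)) F ⧸ affineIdeal F C) x
    obtain ⟨f, rfl⟩ := Ideal.Quotient.mk_surjective a
    obtain ⟨g, rfl⟩ := Ideal.Quotient.mk_surjective b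
    have hg0 : toFunctionField F C g ≠ 0 := fun h =>
      nonZeroDivisors.ne_zero hb (IsFractionRing.to_map_eq_zero_iff.1 h)
    have hX : ∀ k, toFunctionField F C (X 0 ^ k) = 1 := fun k => by
      rw [map_pow, toFunctionField_X_zero, one_pow]
    refine ⟨f.totalDegree + g.totalDegree, toFunctionField F C g,
      ⟨homogenizeAt (X 0) g * X 0 ^ f.totalDegree, ?_, ?_⟩, hg0,
      ⟨homogenizeAt (X 0) f * X 0 ^ g.totalDegree, ?_, ?_⟩⟩
    · rw [add_comm f.totalDegree]
      exact (homogenizeAt_isHomogeneous (isHomogeneous_X F 0) g).mul (isHomogeneous_X_pow _ _)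
    · simp [toFunctionField_homogenizeAt, toFunctionField_X_zero]
    · exact (homogenizeAt_isHomogeneous (isHomogeneous_X F 0) f).mul (isHomogeneous_X_pow _ _)
    · rw [AlgHom.toLinearMap_apply, map_mul, hX, mul_one, toFunctionField_homogenizeAt]
      exact (div_mul_cancel₀ _ hg0).symm

end FunctionField

/-- The bound for the number of rational points of a nondegenerate irreducible set with linear
Hilbert polynomial that comes from counting zeros of the product of all linear forms. -/
theorem ncard_rationalPoints_mul_sum_le [Finite F] {C : Set (ProjSpace K n)}
    (hC : @IsIrreducible _ (zariskiTopology K n) C) (hnd : IsNondegenerate C) {d : ℕ}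
    (hd : HasCurveDegree F C d) :
    (rationalPoints F C).ncard * ∑ i ∈ Finset.Icc 1 n, (Nat.card F ^ i - 1) ≤
      d * (Nat.card F ^ (n + 1) - 1) := by
  have hprime := affineIdeal_isPrime (F := F) hC hnd
  obtain ⟨c, hc⟩ := hilbertFunction_le hd
  choose p hp hpmk using fun P : rationalPoints F C => P.2.2
  have hp0 : ∀ P, p P ≠ 0 := fun P h => hp P (by rw [h]; simp; rfl)
  have hinj : Function.Injective p := by
    intro P Q hPQ
    apply Subtype.ext
    rw [hpmk P, hpmk Q]
    congr 1
    rw [hPQ]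
  have hfin : Finite (rationalPoints F C) := Finite.of_injective p hinj
  have : Fintype (rationalPoints F C) := Fintype.ofFinite _
  have key := card_mul_sum_le (toFunctionField F C) (isLinearGrowthFiltration_forms hc)
    (fun v hv h => not_forall_vanishesAt_linForm hnd hv
      ((mem_affineIdeal_iff_of_isHomogeneous hC hnd (linForm_isHomogeneous v)).1
        (toFunctionField_eq_zero_iff.1 h))) p hp0 ?_ ?_
  · rw [Fintype.card_fin, Nat.add_sub_cancel, ← Nat.card_eq_fintype_card,
      Nat.card_coe_set_eq] at key
    exact key
  · intro P m f hf h
    have h1 := (mem_affineIdeal_iff_of_isHomogeneous hC hnd hf).1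
      (toFunctionField_eq_zero_iff.1 h) P P.2.1
    rw [hpmk P, vanishesAt_mk_iff hf] at h1
    refine (algebraMap F K).injective ?_
    rw [map_zero, ← h1]
    exact (aeval_algebraMap_apply K (p P) f).symm
  · intro P Q hPQ
    refine exists_linForm_separating (hp0 Q) fun a ha => hPQ (Subtype.ext ?_)
    rw [hpmk P, hpmk Q, Projectivization.mk_eq_mk_iff']
    refine ⟨algebraMap F K a, ?_⟩
    funext i
    simp [ha]

end Curves

theorem mainTheorem3 {F K : Type*} [Field F] [Finite F] [Field K] [Algebra F K]
    [IsAlgClosure F K] (n q d : ℕ) (hn : 3 ≤ n) (hq : Nat.card F = q)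
    (C : Set (ProjSpace K n)) (hC : IsAbsolutelyIrreducibleCurve F C)
    (hnd : IsNondegenerate C) (hd : HasCurveDegree F C d) :
    ((d : ℤ) ≥ ((n : ℤ) - 1) * q + 1 →
      ((rationalPoints F C).ncard : ℤ) ≤ q * ((d : ℤ) - n + 1)) ∧
    ((d : ℤ) = ((n : ℤ) - 1) * q →
      ((rationalPoints F C).ncard : ℤ) ≤ q * ((d : ℤ) - n + 1) + 1) := by
  subst hq
  exact le_of_mul_sum_le n (Nat.card F) d _ hn Finite.one_lt_card
    (ncard_rationalPoints_mul_sum_le hC.irreducible hnd hd)
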